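/- Call a (locally small) category \emph{locally finitely presentable} if it is cocomplete and has an essentially small family of finitely presented objects such that every object is a filtered colimit of objects of this family; here an object $K$ is \emph{finitely presented} if $\mathrm{Hom}(K,-)$ preserves small filtered colimits. A \emph{morphism of locally finitely presentable categories} $F:\mathcal{A}\to\mathcal{B}$ is an adjoint pair $F^*\dashv F_*$ with $F_*:\mathcal{A}\to\mathcal{B}$ preserving small filtered colimits. Theorem. Let $\mathcal{A}$ and $\mathcal{B}$ be locally finitely presentable categories and let $F=(F^*\dashv F_*):\mathcal{A}\to\mathcal{B}$ be a morphism between them. Then the comma category $F_*\downarrow\mathcal{B}$, whose objects are the maps $f:F_*(M)\to Y$ with $M\in\mathcal{A}$ and $Y\in\mathcal{B}$, is locally finitely presentable. Moreover, its full subcategory of finitely presented objects coincides with the full subcategory $\mathcal{G}_{F_*}$ of those objects $f:F_*(M)\to Y$ such that $M$ is finitely presented in $\mathcal{A}$ and there are a map $k:K\to K'$ between finitely presented objects of $\mathcal{B}$ and maps $a:K\to F_*(M)$, $a':K'\to Y$ for which the square $f\circ a=a'\circ k$ is a pushout in $\mathcal{B}$. -/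

import Mathlib

open CategoryTheory CategoryTheory.Limits

universe w u₁ u₂

/-- A morphism `F : A ⟶ B` of locally finitely presentable categories: an adjoint pair
`F^* ⊣ F_*` whose right adjoint `F_* : A ⥤ B` is finitary, that is, preserves
(`w`-small) filtered colimits. -/
structure LFPMorphism (A : Type u₁) [Category.{w} A] [IsLocallyFinitelyPresentable.{w} A]
    (B : Type u₂) [Category.{w} B] [IsLocallyFinitelyPresentable.{w} B] where
  /-- The direct image `F_*`. -/
  directImage : A ⥤ B
  /-- The inverse image `F^*`. -/
  inverseImage : B ⥤ A
  /-- The adjunction `F^* ⊣ F_*`. -/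
  adj : inverseImage ⊣ directImage
  /-- `F_*` is finitary. -/
  finitary : PreservesFilteredColimitsOfSize.{w, w} directImage

namespace LFPMorphism

variable {A : Type u₁} [Category.{w} A] [IsLocallyFinitelyPresentable.{w} A]
  {B : Type u₂} [Category.{w} B] [IsLocallyFinitelyPresentable.{w} B]

/-- The comma category `F_* ↓ B`: its objects are the maps `F_*(M) ⟶ Y` of `B`. -/
abbrev DirectImageComma (F : LFPMorphism A B) : Type _ :=
  Comma F.directImage (𝟭 B)

/-- The generator of the comma `F_* ↓ B`: an object `f : F_*(M) ⟶ Y` belongs to it when `M` is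
finitely presented in `A` and `f` is the pushout of some map `k : K ⟶ K'` between finitely
presented objects of `B` along some map `a : K ⟶ F_*(M)`. -/
def commaGenerator (F : LFPMorphism A B) : ObjectProperty F.DirectImageComma := fun f =>
  IsFinitelyPresentable.{w} f.left ∧
    ∃ (K K' : B) (k : K ⟶ K') (a : K ⟶ F.directImage.obj f.left) (a' : K' ⟶ f.right),
      IsFinitelyPresentable.{w} K ∧ IsFinitelyPresentable.{w} K' ∧
        IsPushout k a a' f.hom

end LFPMorphism

/-! Write L for `F_*`. A colimit in the comma is the colimit M of the sources together with the
pushout of colim Y_j along colim L(M_j) ⟶ L(M). Both projections have left adjoints, T and S, and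
are finitary because L is. Hence T and S preserve finite presentability, and since the projections
are jointly faithful and conservative, the images of generators form a strong generator. This gives
local finite presentability, and makes the finitely presented objects the finite colimit closure of
that generator. An object of `commaGenerator` is a pushout of objects T(M), S(K), S(K'). Conversely,
let X be finitely presented. Its source is, because the first projection is cocontinuous. Its map is
a filtered colimit of arrows k_j between finitely presented objects; pushing these out to L(M)
exhibits X as a filtered colimit, so X is a retract of one of the pushouts.
`exists_isPushout_of_retract` splits the idempotent at a finite stage, by a coequalizer. -/

namespace CategoryTheory.Comma

universe v₁ v₂ v₃ u₃

/-! ### Colimits in the comma category. -/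

section Colimits

variable {A : Type u₁} [Category.{v₁} A] {B : Type u₂} [Category.{v₂} B] (L : A ⥤ B)
  {J : Type u₃} [Category.{v₃} J]

section

variable {L} (D : J ⥤ Comma L (𝟭 B))
  {c₁ : Cocone (D ⋙ fst L (𝟭 B))} {c₂ : Cocone (D ⋙ snd L (𝟭 B))}
  {c₀ : Cocone ((D ⋙ fst L (𝟭 B)) ⋙ L)}

/-- The cocone obtained from cocones under the two projections of a diagram in `Comma L (𝟭 B)`
and a commutative square comparing them. -/
def coconeOfSquare {P : B} (p : c₀.pt ⟶ L.obj c₁.pt) (q : c₀.pt ⟶ c₂.pt)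
    (r : L.obj c₁.pt ⟶ P) (s : c₂.pt ⟶ P)
    (hp : ∀ j, c₀.ι.app j ≫ p = L.map (c₁.ι.app j))
    (hq : ∀ j, c₀.ι.app j ≫ q = (D.obj j).hom ≫ c₂.ι.app j)
    (w : p ≫ r = q ≫ s) : Cocone D where
  pt := { left := c₁.pt, right := P, hom := r }
  ι :=
    { app j :=
        { left := c₁.ι.app j
          right := c₂.ι.app j ≫ s
          w := by
            have := hq j
            change L.map (c₁.ι.app j) ≫ r = (D.obj j).hom ≫ c₂.ι.app j ≫ s
            rw [← hp, Category.assoc, w, ← Category.assoc, this, Category.assoc] }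
      naturality i j f := by
        ext
        · simpa using c₁.w f
        · simpa using c₂.w_assoc f s }

/-- The cocone `coconeOfSquare` is a colimit when the given cocones are colimits and the square is
a pushout. -/
noncomputable def isColimitCoconeOfSquare {P : B} (h₀ : IsColimit c₀) (h₁ : IsColimit c₁) (h₂ : IsColimit c₂)
    (p : c₀.pt ⟶ L.obj c₁.pt) (q : c₀.pt ⟶ c₂.pt)
    (r : L.obj c₁.pt ⟶ P) (s : c₂.pt ⟶ P)
    (hp : ∀ j, c₀.ι.app j ≫ p = L.map (c₁.ι.app j))
    (hq : ∀ j, c₀.ι.app j ≫ q = (D.obj j).hom ≫ c₂.ι.app j)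
    (sq : IsPushout p q r s) :
    IsColimit (coconeOfSquare D p q r s hp hq sq.w) where
  desc t :=
    { left := h₁.desc ((fst _ _).mapCocone t)
      right := sq.desc (L.map (h₁.desc ((fst _ _).mapCocone t)) ≫ t.pt.hom)
        (h₂.desc ((snd _ _).mapCocone t)) (h₀.hom_ext fun j => by
          have e₁ := h₁.fac ((fst _ _).mapCocone t) j
          have e₂ := h₂.fac ((snd _ _).mapCocone t) j
          have e₃ := (t.ι.app j).w
          have e₄ := hq j
          rw [← Category.assoc, hp, ← Functor.map_comp_assoc, e₁, ← Category.assoc, e₄,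
            Category.assoc, e₂]
          exact e₃)
      w := (sq.inl_desc _ _ _).symm }
  fac t j := by
    have e₁ := h₁.fac ((fst _ _).mapCocone t) j
    have e₂ := h₂.fac ((snd _ _).mapCocone t) j
    ext
    · exact e₁
    · exact ((Category.assoc _ _ _).trans (c₂.ι.app j ≫= sq.inr_desc _ _ _)).trans e₂
  uniq t m hm := by
    have e : m.left = h₁.desc ((fst _ _).mapCocone t) :=
      h₁.uniq ((fst _ _).mapCocone t) _ fun j =>
        congr($(hm j).left)
    ext
    · exact e
    · refine sq.hom_ext ?_ ?_
      · rw [IsPushout.inl_desc, ← e]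
        exact m.w.symm
      · rw [IsPushout.inr_desc]
        exact h₂.uniq ((snd _ _).mapCocone t) _ fun j =>
          (Category.assoc _ _ _).symm.trans congr($(hm j).right)

end

variable [HasColimitsOfShape J A] [HasColimitsOfShape J B] [HasPushouts B]

lemma exists_isColimit_of_hasPushouts (D : J ⥤ Comma L (𝟭 B)) :
    ∃ (c : Cocone D) (_ : IsColimit c), Nonempty (IsColimit ((fst _ _).mapCocone c)) := by
  let c₁ := colimit.cocone (D ⋙ fst L (𝟭 B))
  let c₂ := colimit.cocone (D ⋙ snd L (𝟭 B))
  let c₀ := colimit.cocone ((D ⋙ fst L (𝟭 B)) ⋙ L)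
  let h₀ : IsColimit c₀ := colimit.isColimit _
  let p := h₀.desc (L.mapCocone c₁)
  let q := h₀.desc
    ((Cocone.precompose (Functor.whiskerLeft D (Comma.natTrans L (𝟭 B)))).obj c₂)
  have hp (j) : c₀.ι.app j ≫ p = L.map (c₁.ι.app j) := h₀.fac _ j
  have hq (j) : c₀.ι.app j ≫ q = (D.obj j).hom ≫ c₂.ι.app j := h₀.fac _ j
  have sq := IsPushout.of_hasPushout p q
  exact ⟨_, isColimitCoconeOfSquare D h₀ (colimit.isColimit _) (colimit.isColimit _) p q _ _
    hp hq sq, ⟨IsColimit.ofIsoColimit (colimit.isColimit _) (Cocone.ext (Iso.refl _)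
      fun j => Category.comp_id _)⟩⟩

instance hasColimitsOfShape_of_hasPushouts : HasColimitsOfShape J (Comma L (𝟭 B)) where
  has_colimit D := by
    obtain ⟨c, hc, _⟩ := exists_isColimit_of_hasPushouts L D
    exact ⟨⟨c, hc⟩⟩

instance preservesColimitsOfShape_fst_of_hasPushouts :
    PreservesColimitsOfShape J (fst L (𝟭 B)) where
  preservesColimit {D} := by
    obtain ⟨c, hc, ⟨hc'⟩⟩ := exists_isColimit_of_hasPushouts L D
    exact preservesColimit_of_preserves_colimit_cocone hc hc'

end Colimits

/-! ### Left adjoints of the two projections. -/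

section Adjunctions

variable {A : Type u₁} [Category.{v₁} A] {B : Type u₂} [Category.{v₂} B] (L : A ⥤ B)

/-- Maps out of `𝟙 : L.obj M ⟶ L.obj M` in `Comma L (𝟭 B)` are maps out of `M`. -/
def homEquivFst (M : A) (X : Comma L (𝟭 B)) :
    ((⟨M, L.obj M, 𝟙 _⟩ : Comma L (𝟭 B)) ⟶ X) ≃ (M ⟶ X.left) where
  toFun f := f.left
  invFun m := { left := m, right := L.map m ≫ X.hom }
  left_inv f := by
    ext
    · rfl
    · have := f.w
      dsimp at this ⊢
      rw [this, Category.id_comp]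
  right_inv _ := rfl

/-- The left adjoint of `Comma.fst L (𝟭 B)`. -/
def leftAdjointFst : A ⥤ Comma L (𝟭 B) :=
  Adjunction.leftAdjointOfEquiv (G := fst L (𝟭 B)) (homEquivFst L) fun _ _ _ _ _ => rfl

/-- The adjunction between `leftAdjointFst L` and `Comma.fst L (𝟭 B)`. -/
def adjunctionFst : leftAdjointFst L ⊣ fst L (𝟭 B) :=
  Adjunction.adjunctionOfEquivLeft (G := fst L (𝟭 B)) (homEquivFst L) fun _ _ _ _ _ => rfl

variable [HasInitial A] [HasBinaryCoproducts B]

/-- Maps out of `L.obj (⊥_ A) ⟶ L.obj (⊥_ A) ⨿ K` in `Comma L (𝟭 B)` are maps out of `K`. -/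
noncomputable def homEquivSnd (K : B) (X : Comma L (𝟭 B)) :
    ((⟨⊥_ A, L.obj (⊥_ A) ⨿ K, coprod.inl⟩ : Comma L (𝟭 B)) ⟶ X) ≃ (K ⟶ X.right) where
  toFun f := coprod.inr ≫ f.right
  invFun m := { left := initial.to _, right := coprod.desc (L.map (initial.to _) ≫ X.hom) m
                w := (coprod.inl_desc _ _).symm }
  left_inv f := by
    have e : f.left = initial.to _ := Subsingleton.elim _ _
    refine CommaMorphism.ext e.symm ?_
    · have := f.w
      refine coprod.hom_ext ?_ ?_
      · exact (coprod.inl_desc _ _).trans (e ▸ this)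
      · exact coprod.inr_desc _ _
  right_inv m := coprod.inr_desc _ _

/-- The left adjoint of `Comma.snd L (𝟭 B)`. -/
noncomputable def leftAdjointSnd : B ⥤ Comma L (𝟭 B) :=
  Adjunction.leftAdjointOfEquiv (G := snd L (𝟭 B)) (homEquivSnd L)
    fun _ _ _ _ _ => by simp [homEquivSnd]

/-- The adjunction between `leftAdjointSnd L` and `Comma.snd L (𝟭 B)`. -/
noncomputable def adjunctionSnd : leftAdjointSnd L ⊣ snd L (𝟭 B) :=
  Adjunction.adjunctionOfEquivLeft (G := snd L (𝟭 B)) (homEquivSnd L)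
    fun _ _ _ _ _ => by simp [homEquivSnd]

end Adjunctions

section Pushout

variable {A : Type u₁} [Category.{v₁} A] {B : Type u₂} [Category.{v₂} B] {L : A ⥤ B}
  {T : A ⥤ Comma L (𝟭 B)} {S : B ⥤ Comma L (𝟭 B)}
  (adjT : T ⊣ fst L (𝟭 B)) (adjS : S ⊣ snd L (𝟭 B))

/-- If `X.hom` is the pushout of `k : K ⟶ K'`, then `X` is the pushout of `S.obj K ⟶ S.obj K'`
along a map from `S.obj K` to `T.obj X.left`, for `T` and `S` the left adjoints of the
projections. -/
lemma isPushout_of_isPushout_hom {X : Comma L (𝟭 B)} {K K' : B} {k : K ⟶ K'}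
    {a : K ⟶ L.obj X.left} {a' : K' ⟶ X.right} (sq : IsPushout k a a' X.hom) :
    IsPushout (S.map k)
      ((adjS.homEquiv K (T.obj X.left)).symm
        (a ≫ L.map (adjT.unit.app X.left) ≫ (T.obj X.left).hom))
      ((adjS.homEquiv K' X).symm a') (adjT.counit.app X) := by
  -- Under the adjunctions, a cocone on the span in the comma becomes a cocone on the span of `k`
  -- and `a` in `B`.
  have key {Z : Comma L (𝟭 B)} (h : T.obj X.left ⟶ Z) :
      (adjS.homEquiv K Z) (((adjS.homEquiv K (T.obj X.left)).symm
        (a ≫ L.map (adjT.unit.app X.left) ≫ (T.obj X.left).hom)) ≫ h) =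
      a ≫ L.map (adjT.homEquiv _ _ h) ≫ Z.hom := by
    rw [Adjunction.homEquiv_naturality_right, Equiv.apply_symm_apply, Adjunction.homEquiv_unit,
      Functor.map_comp, Category.assoc, Category.assoc, Category.assoc]
    exact a ≫= L.map (adjT.unit.app X.left) ≫= h.w.symm
  have hw := sq.w
  have hc : adjT.homEquiv X.left X (adjT.counit.app X) = 𝟙 X.left := by
    rw [Adjunction.homEquiv_unit]
    exact adjT.right_triangle_components X
  have hc' {Z : Comma L (𝟭 B)} (h : X ⟶ Z) :
      adjT.homEquiv X.left Z (adjT.counit.app X ≫ h) = h.left := by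
    rw [Adjunction.homEquiv_naturality_right]
    exact (hc =≫ h.left).trans (Category.id_comp _)
  refine ⟨⟨?_⟩, ⟨PushoutCocone.IsColimit.mk _
    (fun s => ⟨adjT.homEquiv _ _ s.inr,
      sq.desc (adjS.homEquiv _ _ s.inl) (L.map (adjT.homEquiv _ _ s.inr) ≫ s.pt.hom) ?_, ?_⟩)
    (fun s => ?_) (fun s => ?_) (fun s m hl hr => ?_)⟩⟩
  · apply (adjS.homEquiv _ _).injective
    rw [key, Adjunction.homEquiv_naturality_left, Equiv.apply_symm_apply, hw, hc]
    simp
  · rw [← key, ← s.condition, Adjunction.homEquiv_naturality_left]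
  · exact (sq.inr_desc _ _ _).symm
  · apply (adjS.homEquiv _ _).injective
    rw [Adjunction.homEquiv_naturality_right, Equiv.apply_symm_apply]
    exact sq.inl_desc _ _ _
  · apply (adjT.homEquiv _ _).injective
    rw [hc']
  · have e : m.left = adjT.homEquiv _ _ s.inr := by
      rw [← hr, hc']
    ext
    · exact e
    · refine sq.hom_ext ?_ ?_
      · rw [IsPushout.inl_desc, ← hl, Adjunction.homEquiv_naturality_right,
          Equiv.apply_symm_apply]
        rfl
      · rw [IsPushout.inr_desc, ← e]
        exact m.w.symm

end Pushout

end CategoryTheory.Comma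

/-! ### Strong generators and local presentability of the comma. -/

namespace CategoryTheory

universe v₁ v₂ v₃ u₃

/-- Given functors with left adjoints that jointly reflect equality of morphisms and isomorphisms,
the images of strong generators under the left adjoints form a strong generator. -/
lemma ObjectProperty.IsStrongGenerator.sup_ofObj_of_adjunction
    {C : Type u₁} [Category.{v₁} C] {A : Type u₂} [Category.{v₂} A] {B : Type u₃} [Category.{v₃} B]
    {T : A ⥤ C} {G : C ⥤ A} (adjT : T ⊣ G) {S : B ⥤ C} {H : C ⥤ B} (adjS : S ⊣ H)
    (hom_ext : ∀ ⦃X Y : C⦄ (f g : X ⟶ Y), G.map f = G.map g → H.map f = H.map g → f = g)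
    (isIso : ∀ ⦃X Y : C⦄ (f : X ⟶ Y), IsIso (G.map f) → IsIso (H.map f) → IsIso f)
    {P : ObjectProperty A} (hP : P.IsStrongGenerator)
    {Q : ObjectProperty B} (hQ : Q.IsStrongGenerator) :
    ((ObjectProperty.ofObj fun M : Subtype P => T.obj M.1) ⊔
      (ObjectProperty.ofObj fun K : Subtype Q => S.obj K.1)).IsStrongGenerator := by
  have := adjT.isRightAdjoint
  have := adjS.isRightAdjoint
  rw [ObjectProperty.isStrongGenerator_iff]
  refine ⟨fun X Y f g hfg => hom_ext _ _ ?_ ?_, fun X Y i _ hi => isIso _ ?_ ?_⟩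
  · refine hP.isSeparating _ _ fun M hM h => (adjT.homEquiv _ _).symm.injective ?_
    rw [adjT.homEquiv_naturality_right_symm, adjT.homEquiv_naturality_right_symm]
    exact hfg _ (Or.inl ⟨⟨M, hM⟩⟩) _
  · refine hQ.isSeparating _ _ fun M hM h => (adjS.homEquiv _ _).symm.injective ?_
    rw [adjS.homEquiv_naturality_right_symm, adjS.homEquiv_naturality_right_symm]
    exact hfg _ (Or.inr ⟨⟨M, hM⟩⟩) _
  -- Right adjoints preserve monomorphisms, so it is enough to lift maps out of the generators, by
  -- transposition.
  · refine hP.isIso_of_mono _ fun M hM h => ?_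
    obtain ⟨f, hf⟩ := hi _ (Or.inl ⟨⟨M, hM⟩⟩) ((adjT.homEquiv _ _).symm h)
    exact ⟨adjT.homEquiv _ _ f, by
      dsimp only at hf ⊢
      rw [← adjT.homEquiv_naturality_right, hf, Equiv.apply_symm_apply]⟩
  · refine hQ.isIso_of_mono _ fun M hM h => ?_
    obtain ⟨f, hf⟩ := hi _ (Or.inr ⟨⟨M, hM⟩⟩) ((adjS.homEquiv _ _).symm h)
    exact ⟨adjS.homEquiv _ _ f, by
      dsimp only at hf ⊢
      rw [← adjS.homEquiv_naturality_right, hf, Equiv.apply_symm_apply]⟩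

section

attribute [local instance] Cardinal.fact_isRegular_aleph0

variable {C : Type u₁} [Category.{v₁} C] [LocallySmall.{w} C] {J : Type} [SmallCategory J]
  [FinCategory J]

lemma isFinitelyPresentable_of_isColimit {D : J ⥤ C} {c : Cocone D} (hc : IsColimit c)
    (h : ∀ j, IsFinitelyPresentable.{w} (D.obj j)) : IsFinitelyPresentable.{w} c.pt :=
  isCardinalPresentable_of_isColimit c hc Cardinal.aleph0
    (by simp only [hasCardinalLT_aleph0_iff]; infer_instance)

lemma isFinitelyPresentable_colimit (D : J ⥤ C) [HasColimit D]
    (h : ∀ j, IsFinitelyPresentable.{w} (D.obj j)) : IsFinitelyPresentable.{w} (colimit D) :=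
  isFinitelyPresentable_of_isColimit (colimit.isColimit D) h

end

namespace Comma

attribute [local instance] Cardinal.fact_isRegular_aleph0

variable {A : Type u₁} [Category.{w} A] [IsLocallyFinitelyPresentable.{w} A]
  {B : Type u₂} [Category.{w} B] [IsLocallyFinitelyPresentable.{w} B]
  (L : A ⥤ B) [PreservesFilteredColimitsOfSize.{w, w} L]

open Cardinal

instance isFinitelyAccessible_fst : (fst L (𝟭 B)).IsFinitelyAccessible.{w} :=
  Functor.IsFinitelyAccessible_iff_preservesFilteredColimitsOfSize.2
    ⟨fun _ _ _ => inferInstance⟩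

instance isFinitelyAccessible_snd : (snd L (𝟭 B)).IsFinitelyAccessible.{w} :=
  Functor.IsFinitelyAccessible_iff_preservesFilteredColimitsOfSize.2 ⟨fun J _ _ => by
    have : PreservesColimitsOfShape J L :=
      PreservesFilteredColimitsOfSize.preserves_filtered_colimits J
    infer_instance⟩

/-- A small strong generator of `Comma L (𝟭 B)` that consists of finitely presentable objects:
the images of finitely presentable objects under the left adjoints of the two projections. -/
lemma exists_isStrongGenerator :
    ∃ (P : ObjectProperty A) (Q : ObjectProperty B) (R : ObjectProperty (Comma L (𝟭 B)))
      (_ : ObjectProperty.Small.{w} R), P ≤ ObjectProperty.isFinitelyPresentable.{w} A ∧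
      Q ≤ ObjectProperty.isFinitelyPresentable.{w} B ∧
      R.IsStrongGenerator ∧ R ≤ ObjectProperty.isFinitelyPresentable.{w} _ ∧
      R = (ObjectProperty.ofObj fun M : Subtype P => (leftAdjointFst L).obj M.1) ⊔
        (ObjectProperty.ofObj fun K : Subtype Q => (leftAdjointSnd L).obj K.1) := by
  obtain ⟨P, _, hP⟩ := HasCardinalFilteredGenerator.exists_small_generator A ℵ₀
  obtain ⟨Q, _, hQ⟩ := HasCardinalFilteredGenerator.exists_small_generator B ℵ₀
  let adjT := adjunctionFst L
  let adjS := adjunctionSnd L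
  refine ⟨P, Q, _, inferInstance, hP.le_isCardinalPresentable, hQ.le_isCardinalPresentable,
    ObjectProperty.IsStrongGenerator.sup_ofObj_of_adjunction adjT adjS
      (fun X Y f g h₁ h₂ => CommaMorphism.ext h₁ h₂) (fun X Y f (h₁ : IsIso f.left)
      (h₂ : IsIso f.right) => ?_) hP.isStrongGenerator hQ.isStrongGenerator, ?_, rfl⟩
  · exact (isoMk (asIso f.left) (asIso f.right) f.w).isIso_hom
  · rintro _ (⟨⟨M, hM⟩⟩ | ⟨⟨K, hK⟩⟩)
    · have : IsCardinalPresentable M ℵ₀ := hP.le_isCardinalPresentable _ hM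
      exact adjT.isCardinalPresentable_leftAdjoint_obj ℵ₀ M
    · have : IsCardinalPresentable K ℵ₀ := hQ.le_isCardinalPresentable _ hK
      exact adjS.isCardinalPresentable_leftAdjoint_obj ℵ₀ K

instance isLocallyFinitelyPresentable : IsLocallyFinitelyPresentable.{w} (Comma L (𝟭 B)) := by
  have : HasColimitsOfSize.{w, w} (Comma L (𝟭 B)) := ⟨fun _ _ => inferInstance⟩
  obtain ⟨_, _, R, _, _, _, h₁, h₂, _⟩ := exists_isStrongGenerator L
  exact (IsCardinalLocallyPresentable.iff_exists_isStrongGenerator _ _).2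
    ⟨R, inferInstance, h₁, h₂⟩

/-- Finitely presentable objects are finite colimits, iterated, of the strong generator, so a
cocontinuous functor need only be tested on the values of the two left adjoints. -/
lemma isFinitelyPresentable_obj_of_preservesColimits {C : Type u₃} [Category.{w} C]
    (G : Comma L (𝟭 B) ⥤ C) [PreservesColimitsOfSize.{w, w} G]
    (hT : ∀ M : A, IsFinitelyPresentable.{w} M →
      IsFinitelyPresentable.{w} (G.obj ((leftAdjointFst L).obj M)))
    (hS : ∀ K : B, IsFinitelyPresentable.{w} K →
      IsFinitelyPresentable.{w} (G.obj ((leftAdjointSnd L).obj K)))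
    (X : Comma L (𝟭 B)) (hX : IsFinitelyPresentable.{w} X) :
    IsFinitelyPresentable.{w} (G.obj X) := by
  obtain ⟨P, Q, R, _, hP, hQ, h₁, h₂, rfl⟩ := exists_isStrongGenerator L
  have hX' := (IsStrongGenerator.colimitsCardinalClosure_eq_isCardinalPresentable
    (κ := ℵ₀) h₁ h₂).le X hX
  refine (ObjectProperty.colimitsCardinalClosure_le
    (Q := (isCardinalPresentable C ℵ₀).inverseImage G) _ _ (fun J _ hJ => ?_) ?_) X hX'
  · refine ⟨?_⟩
    rintro Y ⟨p⟩
    exact (isClosedUnderColimitsOfShape_isCardinalPresentable C hJ).colimitsOfShape_le _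
      ⟨⟨p.toColimitPresentation.map G, p.prop_diag_obj⟩⟩
  · rintro _ (⟨⟨M, hM⟩⟩ | ⟨⟨K, hK⟩⟩)
    · exact hT _ (hP _ hM)
    · exact hS _ (hQ _ hK)

lemma isFinitelyPresentable_left (X : Comma L (𝟭 B)) [hX : IsFinitelyPresentable.{w} X] :
    IsFinitelyPresentable.{w} X.left := by
  have : PreservesColimitsOfSize.{w, w} (fst L (𝟭 B)) := ⟨inferInstance⟩
  exact isFinitelyPresentable_obj_of_preservesColimits L (fst L (𝟭 B)) (fun M hM => hM)
    (fun K _ => isFinitelyPresentable_colimit _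
      fun j => nomatch j) X hX

lemma isFinitelyPresentable_right_of_id (X : Comma (𝟭 B) (𝟭 B))
    [hX : IsFinitelyPresentable.{w} X] : IsFinitelyPresentable.{w} X.right := by
  have : PreservesFilteredColimitsOfSize.{w, w} (𝟭 B) := ⟨inferInstance⟩
  have : PreservesColimitsOfSize.{w, w} (snd (𝟭 B) (𝟭 B)) := ⟨inferInstance⟩
  refine isFinitelyPresentable_obj_of_preservesColimits (𝟭 B) (snd (𝟭 B) (𝟭 B)) (fun M hM => hM)
    (fun K hK => ?_) X hX
  -- For the identity functor, the target of `S(K)` is the coproduct of the initial object and `K`.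
  refine isFinitelyPresentable_colimit _ ?_
  rintro ⟨_ | _⟩
  · exact isFinitelyPresentable_colimit _ fun j => nomatch j
  · exact hK

lemma isFinitelyPresentable_of_isPushout {X : Comma L (𝟭 B)} {K K' : B} {k : K ⟶ K'}
    {a : K ⟶ L.obj X.left} {a' : K' ⟶ X.right} (sq : IsPushout k a a' X.hom)
    [IsFinitelyPresentable.{w} K] [IsFinitelyPresentable.{w} K']
    [IsFinitelyPresentable.{w} X.left] : IsFinitelyPresentable.{w} X := by
  have sq' := isPushout_of_isPushout_hom (adjunctionFst L) (adjunctionSnd L) sq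
  exact isFinitelyPresentable_of_isColimit sq'.isColimit (by
    rintro (_ | _ | _)
    · exact (adjunctionSnd L).isCardinalPresentable_leftAdjoint_obj ℵ₀ K
    · exact (adjunctionSnd L).isCardinalPresentable_leftAdjoint_obj ℵ₀ K'
    · exact (adjunctionFst L).isCardinalPresentable_leftAdjoint_obj ℵ₀ X.left)

end CategoryTheory.Comma

/-! ### Retracts of pushouts, and arrows as filtered colimits. -/

namespace CategoryTheory

universe v₁ v₂

section

variable {C : Type u₁} [Category.{v₁} C] {J : Type u₂} [Category.{v₂} J]

/-- The colimit of a pointwise pushout of functors is the pushout of the colimits. -/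
noncomputable def isColimitOfIsPushout {X Y Z W : J ⥤ C} {p : X ⟶ Y} {q : X ⟶ Z} {r : Y ⟶ W}
    {s : Z ⟶ W} (sq : ∀ j, IsPushout (p.app j) (q.app j) (r.app j) (s.app j))
    {cX : Cocone X} {cY : Cocone Y} {cZ : Cocone Z} {cW : Cocone W}
    (hX : IsColimit cX) (hY : IsColimit cY) (hZ : IsColimit cZ)
    {p' : cX.pt ⟶ cY.pt} {q' : cX.pt ⟶ cZ.pt} {r' : cY.pt ⟶ cW.pt} {s' : cZ.pt ⟶ cW.pt}
    (hp : ∀ j, cX.ι.app j ≫ p' = p.app j ≫ cY.ι.app j)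
    (hq : ∀ j, cX.ι.app j ≫ q' = q.app j ≫ cZ.ι.app j)
    (hr : ∀ j, cY.ι.app j ≫ r' = r.app j ≫ cW.ι.app j)
    (hs : ∀ j, cZ.ι.app j ≫ s' = s.app j ≫ cW.ι.app j)
    (sq' : IsPushout p' q' r' s') : IsColimit cW :=
  have fY (t : Cocone W) (j) :
      cY.ι.app j ≫ hY.desc ((Cocone.precompose r).obj t) = r.app j ≫ t.ι.app j := hY.fac _ j
  have fZ (t : Cocone W) (j) :
      cZ.ι.app j ≫ hZ.desc ((Cocone.precompose s).obj t) = s.app j ≫ t.ι.app j := hZ.fac _ j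
  { desc t := sq'.desc (hY.desc ((Cocone.precompose r).obj t))
      (hZ.desc ((Cocone.precompose s).obj t)) (hX.hom_ext fun j => by
        rw [reassoc_of% (hp j), reassoc_of% (hq j), fY, fZ, (sq j).w_assoc])
    fac t j := by
      refine (sq j).hom_ext ?_ ?_
      · rw [← reassoc_of% (hr j), IsPushout.inl_desc, fY]
      · rw [← reassoc_of% (hs j), IsPushout.inr_desc, fZ]
    uniq t m hm := by
      refine sq'.hom_ext (hY.hom_ext fun j => ?_) (hZ.hom_ext fun j => ?_)
      · rw [IsPushout.inl_desc, fY, reassoc_of% (hr j), hm]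
      · rw [IsPushout.inr_desc, fZ, reassoc_of% (hs j), hm] }

/-- Let `f : U ⟶ Y` be a retract under `U` of the pushout `d : U ⟶ P` of `k : K ⟶ K'`. If the
resulting idempotent of `P` is induced by a map `t` from `K'` to the pushout `W` of `k` along some
`φ : K ⟶ K₁` over `U`, then `f` is a pushout of a map from `K₁` to a coequalizer of `K' ⇉ W`. -/
lemma exists_isPushout_coequalizer {K K' K₁ U W P Y : C} {k : K ⟶ K'} {φ : K ⟶ K₁} {r : K' ⟶ W}
    {s : K₁ ⟶ W} (hW : IsPushout k φ r s) {a : K ⟶ U} {b : K' ⟶ P} {d : U ⟶ P}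
    (sq : IsPushout k a b d) {a₁ : K₁ ⟶ U} (ha : φ ≫ a₁ = a) {ω : W ⟶ P} (hr : r ≫ ω = b)
    (hs : s ≫ ω = a₁ ≫ d) {f : U ⟶ Y} {g : Y ⟶ P} {β : P ⟶ Y} (hfg : f ≫ g = d)
    (hdβ : d ≫ β = f) (hgβ : g ≫ β = 𝟙 Y) {t : K' ⟶ W} (ht : t ≫ ω = b ≫ β ≫ g)
    [HasCoequalizer t r] :
    ∃ α' : coequalizer t r ⟶ Y, IsPushout (s ≫ coequalizer.π t r) a₁ α' f := by
  have hα : t ≫ ω ≫ β = r ≫ ω ≫ β := by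
    rw [reassoc_of% ht, reassoc_of% hr, hgβ, Category.comp_id]
  -- A cocone `(u, v)` on the candidate square induces `y : P ⟶ Z`. As `π` coequalizes `t` and `r`,
  -- `y` is invariant under the idempotent `β ≫ g`, hence factors through `Y` as `g ≫ y`.
  have hcompat {Z : C} (u : coequalizer t r ⟶ Z) (v : U ⟶ Z)
      (huv : (s ≫ coequalizer.π t r) ≫ u = a₁ ≫ v) : k ≫ r ≫ coequalizer.π t r ≫ u = a ≫ v := by
    rw [hW.w_assoc, ← Category.assoc s, huv, reassoc_of% ha]
  have hω {Z : C} (u : coequalizer t r ⟶ Z) (v : U ⟶ Z) (y : P ⟶ Z)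
      (huv : (s ≫ coequalizer.π t r) ≫ u = a₁ ≫ v)
      (hb : b ≫ y = r ≫ coequalizer.π t r ≫ u) (hd : d ≫ y = v) :
      ω ≫ y = coequalizer.π t r ≫ u := by
    refine hW.hom_ext ?_ ?_
    · rw [reassoc_of% hr, hb]
    · rw [reassoc_of% hs, hd, ← huv, Category.assoc]
  have hβg {Z : C} (u : coequalizer t r ⟶ Z) (y : P ⟶ Z)
      (hb : b ≫ y = r ≫ coequalizer.π t r ≫ u) (hy : ω ≫ y = coequalizer.π t r ≫ u) :
      β ≫ g ≫ y = y := by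
    refine sq.hom_ext ?_ ?_
    · rw [← reassoc_of% ht, hy, coequalizer.condition_assoc, hb]
    · rw [reassoc_of% hdβ, reassoc_of% hfg]
  refine ⟨coequalizer.desc (ω ≫ β) hα, ⟨?_⟩, ⟨PushoutCocone.IsColimit.mk _
    (fun z => g ≫ sq.desc (r ≫ coequalizer.π t r ≫ z.inl) z.inr (hcompat _ _ z.condition))
    (fun z => ?_) (fun z => ?_) (fun z m hl hm => ?_)⟩⟩
  · rw [Category.assoc, coequalizer.π_desc, reassoc_of% hs, hdβ]
  · have hb := sq.inl_desc _ _ (hcompat _ _ z.condition)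
    have hd := sq.inr_desc _ _ (hcompat _ _ z.condition)
    have hy := hω _ _ _ z.condition hb hd
    refine coequalizer.hom_ext ?_
    rw [coequalizer.π_desc_assoc, Category.assoc, hβg _ _ hb hy, hy]
  · rw [reassoc_of% hfg, IsPushout.inr_desc]
  · have : β ≫ m = sq.desc _ _ (hcompat _ _ z.condition) := by
      refine sq.hom_ext ?_ ?_
      · rw [IsPushout.inl_desc, ← hl, coequalizer.π_desc_assoc, Category.assoc, reassoc_of% hr]
      · rw [IsPushout.inr_desc, reassoc_of% hdβ, hm]
    rw [← this, reassoc_of% hgβ]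

/-- A pushout of colimits of functors is the colimit of a pointwise pushout. -/
lemma exists_isColimit_of_isPushout [HasPushouts C] {X Y Z : J ⥤ C} (p : X ⟶ Y) (q : X ⟶ Z)
    {cX : Cocone X} {cY : Cocone Y} {cZ : Cocone Z}
    (hX : IsColimit cX) (hY : IsColimit cY) (hZ : IsColimit cZ) {P : C}
    {p' : cX.pt ⟶ cY.pt} {q' : cX.pt ⟶ cZ.pt} {r' : cY.pt ⟶ P} {s' : cZ.pt ⟶ P}
    (hp : ∀ j, cX.ι.app j ≫ p' = p.app j ≫ cY.ι.app j)
    (hq : ∀ j, cX.ι.app j ≫ q' = q.app j ≫ cZ.ι.app j)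
    (sq' : IsPushout p' q' r' s') :
    ∃ (W : J ⥤ C) (r : Y ⟶ W) (s : Z ⟶ W) (cW : W ⟶ (Functor.const J).obj P),
      (∀ j, IsPushout (p.app j) (q.app j) (r.app j) (s.app j)) ∧
      (∀ j, r.app j ≫ cW.app j = cY.ι.app j ≫ r') ∧
      (∀ j, s.app j ≫ cW.app j = cZ.ι.app j ≫ s') ∧ Nonempty (IsColimit (Cocone.mk P cW)) := by
  have sq := IsPushout.of_hasPushout p q
  have w : p ≫ cY.ι ≫ (Functor.const J).map r' = q ≫ cZ.ι ≫ (Functor.const J).map s' := by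
    ext j
    simp only [NatTrans.comp_app, Functor.const_map_app]
    rw [← reassoc_of% (hp j), ← reassoc_of% (hq j), sq'.w]
  have sqj (j) := sq.map ((evaluation J C).obj j)
  have hr (j) := congr_app (sq.inl_desc _ _ w) j
  have hs (j) := congr_app (sq.inr_desc _ _ w) j
  exact ⟨pushout p q, pushout.inl p q, pushout.inr p q, sq.desc _ _ w, sqj, hr, hs,
    ⟨isColimitOfIsPushout sqj hX hY hZ (cW := Cocone.mk P (sq.desc _ _ w)) hp hq
      (fun j => (hr j).symm) (fun j => (hs j).symm) sq'⟩⟩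

end

section

attribute [local instance] Cardinal.fact_isRegular_aleph0
open Cardinal

variable {B : Type u₂} [Category.{w} B] [IsLocallyFinitelyPresentable.{w} B]

/-- Let `U` be a filtered colimit of finitely presentable objects `K j`, and let `U ⟶ Y` be a
retract under `U` of a pushout of a map from some `K j` to a finitely presentable object. Then
`U ⟶ Y` is itself a pushout of a map between finitely presentable objects. -/
lemma exists_isPushout_of_retract {J : Type w} [SmallCategory J] [IsFiltered J] {K : J ⥤ B}
    (hK : ∀ j, IsFinitelyPresentable.{w} (K.obj j)) {c : Cocone K} (hc : IsColimit c) (j : J)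
    {K' : B} [IsFinitelyPresentable.{w} K'] {k : K.obj j ⟶ K'} {P Y : B} {b : K' ⟶ P}
    {d : c.pt ⟶ P} (sq : IsPushout k (c.ι.app j) b d) {f : c.pt ⟶ Y} {g : Y ⟶ P} {β : P ⟶ Y}
    (hfg : f ≫ g = d) (hdβ : d ≫ β = f) (hgβ : g ≫ β = 𝟙 Y) :
    ∃ (K₁ K₁' : B) (κ : K₁ ⟶ K₁') (α : K₁ ⟶ c.pt) (α' : K₁' ⟶ Y),
      IsFinitelyPresentable.{w} K₁ ∧ IsFinitelyPresentable.{w} K₁' ∧ IsPushout κ α α' f := by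
  let q : (Functor.const (Under j)).obj (K.obj j) ⟶ Under.forget j ⋙ K :=
    { app i := K.map i.hom
      naturality i i' φ := by
        simp [← Functor.map_comp] }
  have := IsFiltered.isConnected (Under j)
  obtain ⟨W, r, s, cW, hW, hr, hs, ⟨hcW⟩⟩ :=
    exists_isColimit_of_isPushout ((Functor.const (Under j)).map k) q
      (isColimitConstCocone _ _) (isColimitConstCocone _ _)
      ((Functor.Final.isColimitWhiskerEquiv (Under.forget j) c).symm hc)
      (p' := k) (q' := c.ι.app j) 
      (fun _ => (Category.id_comp k).trans (Category.comp_id k).symm)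
      (fun i => (Category.id_comp _).trans (c.w i.hom).symm) sq
  -- `P` is the filtered colimit of the pushouts of `k` along `K j ⟶ K i`, so the idempotent
  -- restricted to `K'` is already defined at some stage `i`.
  obtain ⟨i, t, ht⟩ := IsFinitelyPresentable.exists_hom_of_isColimit hcW (b ≫ β ≫ g)
  have hWi' : IsFinitelyPresentable.{w} (W.obj i) :=
    isFinitelyPresentable_of_isColimit (hW i).isColimit (by
      rintro (_ | _ | _)
      exacts [hK _, ‹IsFinitelyPresentable.{w} K'›, hK _])
  obtain ⟨α', h⟩ := exists_isPushout_coequalizer (hW i) sq (c.w i.hom)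
    ((hr i).trans (Category.id_comp _)) (hs i) hfg hdβ hgβ ht
  exact ⟨_, _, _, _, α', hK _, isFinitelyPresentable_colimit _ (by
    rintro (_ | _)
    exacts [‹IsFinitelyPresentable.{w} K'›, hWi']), h⟩

/-- Every morphism is a filtered colimit of morphisms between finitely presentable objects. -/
lemma exists_isColimit_of_hom {U Y : B} (f : U ⟶ Y) :
    ∃ (J : Type w) (_ : SmallCategory J) (_ : IsFiltered J) (K K' : J ⥤ B) (k : K ⟶ K')
      (a : K ⟶ (Functor.const J).obj U) (a' : K' ⟶ (Functor.const J).obj Y),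
      (∀ j, IsFinitelyPresentable.{w} (K.obj j)) ∧ (∀ j, IsFinitelyPresentable.{w} (K'.obj j)) ∧
      Nonempty (IsColimit (Cocone.mk U a)) ∧ Nonempty (IsColimit (Cocone.mk Y a')) ∧
      ∀ j, k.app j ≫ a'.app j = a.app j ≫ f := by
  have : PreservesFilteredColimitsOfSize.{w, w} (𝟭 B) := ⟨inferInstance⟩
  obtain ⟨J, _, hJ, ⟨p⟩⟩ := (isCardinalFilteredGenerator_isCardinalPresentable
    (Comma (𝟭 B) (𝟭 B)) ℵ₀).exists_colimitsOfShape ⟨U, Y, f⟩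
  have hJ' : IsFiltered J := isFiltered_of_isCardinalFiltered J ℵ₀
  have hp (j) : IsFinitelyPresentable.{w} (p.diag.obj j) := p.prop_diag_obj j
  refine ⟨J, inferInstance, hJ', p.diag ⋙ Comma.fst _ _, p.diag ⋙ Comma.snd _ _,
    Functor.whiskerLeft p.diag (Comma.natTrans (𝟭 B) (𝟭 B)),
    { app j := (p.ι.app j).left
      naturality i j φ := congr($(p.ι.naturality φ).left) },
    { app j := (p.ι.app j).right
      naturality i j φ := congr($(p.ι.naturality φ).right) },
    fun j => Comma.isFinitelyPresentable_left (𝟭 B) (p.diag.obj j),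
    fun j => Comma.isFinitelyPresentable_right_of_id (p.diag.obj j),
    ⟨isColimitOfPreserves (Comma.fst _ _) p.isColimit⟩,
    ⟨isColimitOfPreserves (Comma.snd _ _) p.isColimit⟩, fun j => (p.ι.app j).w.symm⟩

end

namespace Comma

attribute [local instance] Cardinal.fact_isRegular_aleph0

variable {A : Type u₁} [Category.{w} A]
  {B : Type u₂} [Category.{w} B] [IsLocallyFinitelyPresentable.{w} B]
  {L : A ⥤ B} [PreservesFilteredColimitsOfSize.{w, w} L]

lemma exists_isPushout_of_isFinitelyPresentable (X : Comma L (𝟭 B))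
    [IsFinitelyPresentable.{w} X] :
    ∃ (K K' : B) (k : K ⟶ K') (a : K ⟶ L.obj X.left) (a' : K' ⟶ X.right),
      IsFinitelyPresentable.{w} K ∧ IsFinitelyPresentable.{w} K' ∧ IsPushout k a a' X.hom := by
  obtain ⟨J, _, _, K, K', k, a, a', hK, hK', ⟨ha⟩, ⟨ha'⟩, hk⟩ := exists_isColimit_of_hom X.hom
  have := IsFiltered.isConnected J
  -- The pushouts `W j` of `k j` along `a j` have as colimit the pushout of `X.hom` along the
  -- identity, namely `X.right`.
  obtain ⟨W, r, s, cW, hW, hr, hs, ⟨hcW⟩⟩ :=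
    exists_isColimit_of_isPushout k a ha ha' (isColimitConstCocone J (L.obj X.left))
      (p' := X.hom) (q' := 𝟙 _) (fun j => (hk j).symm) (fun j => rfl)
      (IsPushout.of_vert_isIso ⟨by simp⟩ : IsPushout X.hom (𝟙 _) (𝟙 _) X.hom)
  let D : J ⥤ Comma L (𝟭 B) :=
    { obj j := ⟨X.left, W.obj j, s.app j⟩
      map {i j} φ :=
        { left := 𝟙 _
          right := W.map φ
          w := (congr(L.map (𝟙 _) ≫ s.app j).trans (by simp)).trans (s.naturality φ) }
      map_id j := CommaMorphism.ext rfl (W.map_id j)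
      map_comp φ ψ := CommaMorphism.ext (Category.comp_id _).symm (W.map_comp φ ψ) }
  let cD : Cocone D :=
    { pt := X
      ι :=
        { app j :=
            { left := 𝟙 _
              right := cW.app j
              w := ((L.map_id X.left =≫ X.hom).trans (hs j).symm) }
          naturality i j φ := CommaMorphism.ext rfl (cW.naturality φ) } }
  have hcD : IsColimit cD := by
    have : PreservesColimitsOfShape J L :=
      PreservesFilteredColimitsOfSize.preserves_filtered_colimits J
    refine fstSndJointlyReflectColimit
      (IsColimit.ofIsoColimit (isColimitConstCocone J X.left) (Cocone.ext (Iso.refl _)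
        fun j => Category.comp_id _))
      hcW
  -- Finite presentability of `X` lifts its identity to some stage, making `X` a retract of `L(M) ⟶
  -- W j`.
  obtain ⟨j, g, hg⟩ := IsFinitelyPresentable.exists_hom_of_isColimit hcD (𝟙 X)
  have hl : g.left = 𝟙 X.left := (Category.comp_id _).symm.trans congr($(hg).left)
  have := hK' j
  refine exists_isPushout_of_retract hK ha j (hW j) (f := X.hom) (g := g.right) (β := cW.app j)
    ?_ ?_ congr($(hg).right)
  · have := g.w
    rw [hl, L.map_id] at this
    exact this.symm.trans (Category.id_comp _)
  · exact (hs j).trans (Category.id_comp _)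

end Comma

end CategoryTheory

theorem mainTheorem2 {A : Type u₁} [Category.{w} A] [IsLocallyFinitelyPresentable.{w} A]
    {B : Type u₂} [Category.{w} B] [IsLocallyFinitelyPresentable.{w} B]
    (F : LFPMorphism A B) :
    IsLocallyFinitelyPresentable.{w} F.DirectImageComma ∧
      ObjectProperty.isFinitelyPresentable.{w} F.DirectImageComma = F.commaGenerator := by
  have := F.finitary
  refine ⟨Comma.isLocallyFinitelyPresentable F.directImage, ?_⟩
  ext X
  constructor
  · intro (hX : IsFinitelyPresentable.{w} X)
    exact ⟨Comma.isFinitelyPresentable_left F.directImage X,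
      Comma.exists_isPushout_of_isFinitelyPresentable X⟩
  · rintro ⟨_, K, K', k, a, a', _, _, sq⟩
    exact Comma.isFinitelyPresentable_of_isPushout F.directImage sq
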